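/- Let $q$ be a prime power, $1\le n\le m$ and $0\le\rho\le n$. The rank weight $\mathrm{rk}(x)$ of $x\in\mathrm{GF}(q^m)^n$ is the maximum number of coordinates of $x$ that are linearly independent over $\mathrm{GF}(q)$, and the rank distance is $d_R(x,y)=\mathrm{rk}(x-y)$. A vector is covered by a code with radius $\rho$ if it is at distance at most $\rho$ from some codeword; the covering radius of a nonempty code $C\subseteq\mathrm{GF}(q^m)^n$ is $\max_x d_R(x,C)$, and $K_R(q^m,n,\rho)$ is the minimum cardinality of a code with covering radius $\rho$. Let $v(\rho)$ be the number of vectors in a ball of rank radius $\rho$, let $I(\rho,w)$ be the number of vectors in the intersection of two balls of radius $\rho$ whose centers are at distance $w$, and let $M(d,r)$ be the number of codewords of rank $r$ in an $(n,n-d+1,d)$ linear MRD code, i.e. a linear code of length $n$, dimension $n-d+1$ over $\mathrm{GF}(q^m)$ and minimum rank distance $d$ (these numbers do not depend on the choice of the centers or of the code). For $K\ge1$ put $l=\lfloor\log_{q^m}K\rfloor$ and $$B(K)=v(\rho)+\sum_{b=1}^{l}\bigl(q^{bm}-q^{(b-1)m}\bigr)\bigl[v(\rho)-I(\rho,n-b+1)\bigr]+\bigl(K-q^{lm}\bigr)\bigl[v(\rho)-I(\rho,n-l)\bigr].$$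 Let $a=\min\{n,2\rho\}$ and $K_0=q^{m(n-a)}$. For $K_0\le k<q^{mn}$ let $d_k=n-\lceil\log_{q^m}(k+1)\rceil+1$, and for $d_k\le l\le a$ define successively $\mu^{(k)}_l=\min\bigl\{M(d_k,l),\,k-\sum_{j=d_k}^{l-1}\mu^{(k)}_j\bigr\}$ (so that $\mu^{(k)}_{d_k}=\min\{M(d_k,d_k),k\}$). Define two integer sequences $h_k,u'_k$, $K_0\le k\le q^{mn}$, by $h_{K_0}=u'_{K_0}=q^{mn}-q^{m(n-a)}v(\rho)$ and, for $K_0\le k<q^{mn}$, $$h_{k+1}=h_k-v(\rho)+\sum_{l=d_k}^{a}\mu^{(k)}_l\,I(\rho,l),\qquad u'_{k+1}=\min\left\{h_{k+1},\;u'_k-\left\lceil\frac{u'_k\,v(\rho)}{\min\{q^{mn}-k,\;B(u'_k)\}}\right\rceil\right\},$$ where the fraction is read as $0$ when $u'_k=0$. Then for every $k$ with $K_0\le k\le q^{mn}$ there is a code of cardinality $k$ that leaves at most $h_k$ vectors of $\mathrm{GF}(q^m)^n$ uncovered with radius $\rho$, and there is a code of cardinality $k$ that leaves at most $u'_k$ vectors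 uncovered. Moreover $u'_k=0$ for some such $k$, and $$K_R(q^m,n,\rho)\le\min\{k: u'_k=0\}.$$ -/

import Mathlib

namespace RankMetric

section Metric

variable (F : Type*) {K : Type*} [Field F] [Field K] [Algebra F K] {n : ℕ}

/-- Rank weight of a vector `x` of length `n` over the extension field `K` of `F`: the dimension
over `F` of the span of its coordinates, that is, the maximum number of coordinates of `x` that are
linearly independent over `F` (see `isGreatest_rankWeight`). -/
noncomputable def rankWeight (x : Fin n → K) : ℕ :=
  Module.finrank F (Submodule.span F (Set.range x))

theorem isGreatest_rankWeight (x : Fin n → K) :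
    IsGreatest {k : ℕ | ∃ s : Finset (Fin n), s.card = k ∧ LinearIndepOn F x (s : Set (Fin n))}
      (rankWeight F x) := by
  classical
  constructor
  · obtain ⟨t, -, htr, hspan, hli⟩ :=
      exists_linearIndepOn_extension (K := F) (v := x) (linearIndepOn_empty F x)
        (Set.empty_subset (Set.univ : Set (Fin n)))
    refine ⟨t.toFinset, ?_, by simpa using hli⟩
    have hs : Submodule.span F (Set.range x) = Submodule.span F (x '' t) := by
      apply le_antisymm
      · rw [Submodule.span_le, ← Set.image_univ]
        exact hspan
      · exact Submodule.span_mono (Set.image_subset_range _ _)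
    have h1 := finrank_span_eq_card hli
    rw [rankWeight, hs, Set.toFinset_card, Set.image_eq_range]
    exact h1.symm
  · rintro k ⟨s, rfl, hs⟩
    have h1 := finrank_span_eq_card hs
    have h2 : Submodule.span F (Set.range fun i : (s : Set (Fin n)) => x i) ≤
        Submodule.span F (Set.range x) := by
      apply Submodule.span_mono
      rintro _ ⟨i, rfl⟩
      exact ⟨i, rfl⟩
    have : FiniteDimensional F (Submodule.span F (Set.range x)) :=
      FiniteDimensional.span_of_finite F (Set.finite_range x)
    have h3 := Submodule.finrank_mono h2
    rw [h1] at h3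
    simpa [rankWeight] using h3

/-- Rank distance. -/
noncomputable def rankDist (x y : Fin n → K) : ℕ := rankWeight F (x - y)

/-- Closed ball of rank radius `r` around `x`. -/
def ball (r : ℕ) (x : Fin n → K) : Set (Fin n → K) := {y | rankDist F y x ≤ r}

/-- Rank distance from a vector to a code. -/
noncomputable def distToCode (x : Fin n → K) (C : Finset (Fin n → K)) : ℕ :=
  sInf ((fun c => rankDist F x c) '' (C : Set (Fin n → K)))

/-- The (nonempty) code `C` has rank covering radius `ρ`: the largest distance from a vector of the
space to `C` is equal to `ρ`. -/
def HasCoveringRadius (C : Finset (Fin n → K)) (ρ : ℕ) : Prop :=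
  C.Nonempty ∧ IsGreatest (Set.range fun x : Fin n → K => distToCode F x C) ρ

/-- Number of vectors that are not covered by `C` with radius `ρ`. -/
noncomputable def uncovered (ρ : ℕ) (C : Finset (Fin n → K)) : ℕ :=
  {x : Fin n → K | ∀ c ∈ C, ρ < rankDist F x c}.ncard

variable (K) (n)

/-- Minimum cardinality of a code of length `n` over `K` with rank covering radius `ρ`. It takes
values in `ℕ∞`, so that an upper bound includes that such a code exists. -/
noncomputable def minCovering (ρ : ℕ) : ℕ∞ :=
  ⨅ (C : Finset (Fin n → K)) (_ : HasCoveringRadius F C ρ), (C.card : ℕ∞)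

/-- Volume of a ball of rank radius `r`. -/
noncomputable def vol (r : ℕ) : ℕ := (ball F r (0 : Fin n → K)).ncard

/-- Number of vectors in the intersection of two balls of radii `r` and `s` whose centers are at
distance `w`. All pairs of centers at distance `w` give the same number; the supremum
picks this common value. -/
noncomputable def interBalls (r s w : ℕ) : ℕ :=
  sSup {N : ℕ | ∃ x y : Fin n → K, rankDist F x y = w ∧ N = (ball F r x ∩ ball F s y).ncard}

variable {K} {n} in
/-- `C` is an `(n, n - d + 1, d)` linear MRD code: its dimension is `n - d + 1` and its minimum rank
distance is `d`. -/
def IsLinearMRD (d : ℕ) (C : Submodule K (Fin n → K)) : Prop :=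
  Module.finrank K C + d = n + 1 ∧
    IsLeast {w : ℕ | ∃ x ∈ C, ∃ y ∈ C, x ≠ y ∧ w = rankDist F x y} d

/-- Number of codewords of rank `r` in an `(n, n - d + 1, d)` linear MRD code. All linear MRD codes
with these parameters have the same rank distribution; the supremum picks this common value. -/
noncomputable def mrdCount (d r : ℕ) : ℕ :=
  sSup {N : ℕ | ∃ C : Submodule K (Fin n → K), IsLinearMRD F d C ∧
    N = {c : Fin n → K | c ∈ C ∧ rankWeight F c = r}.ncard}

/-- The function `B`, which bounds the volume of a union of `k` balls of rank radius `ρ`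
(for `1 ≤ k ≤ q ^ (m * n)`, where `|K| = q ^ m`). -/
noncomputable def unionBound (ρ k : ℕ) : ℤ :=
  let Q : ℕ := Nat.card K
  let l : ℕ := Nat.log Q k
  (vol F K n ρ : ℤ)
    + ∑ b ∈ Finset.Icc 1 l, ((Q : ℤ) ^ b - (Q : ℤ) ^ (b - 1)) *
        ((vol F K n ρ : ℤ) - interBalls F K n ρ ρ (n - b + 1))
    + ((k : ℤ) - (Q : ℤ) ^ l) * ((vol F K n ρ : ℤ) - interBalls F K n ρ ρ (n - l))

end Metric

/-- Given `M : ℕ → ℕ`, the numbers `μ_l = min (M l) (k - ∑_{d ≤ j < l} μ_j)` for `l ≥ d`; in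
particular `μ_d = min (M d) k`. The sum never exceeds `k`, so the subtraction is exact. -/
def mu (M : ℕ → ℕ) (d k : ℕ) : ℕ → ℕ
  | l => min (M l) (k - ∑ j ∈ (Finset.Ico d l).attach, mu M d k j.1)
termination_by l => l
decreasing_by exact (Finset.mem_Ico.mp j.2).2

theorem mu_eq (M : ℕ → ℕ) (d k l : ℕ) :
    mu M d k l = min (M l) (k - ∑ j ∈ Finset.Ico d l, mu M d k j) := by
  rw [mu, Finset.sum_attach (Finset.Ico d l) (fun j => mu M d k j)]

theorem sum_mu_le (M : ℕ → ℕ) (d k l : ℕ) : ∑ j ∈ Finset.Ico d l, mu M d k j ≤ k := by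
  induction l with
  | zero => simp
  | succ l ih =>
    by_cases h : d ≤ l
    · rw [Finset.sum_Ico_succ_top h, mu_eq]
      omega
    · rw [Finset.Ico_eq_empty (by omega)]
      simp

/-- `d_k = n - ⌈log_Q (k + 1)⌉ + 1`, with `Q = q ^ m` (positive for `1 ≤ k < Q ^ n`). -/
def dIndex (Q n k : ℕ) : ℕ := n + 1 - Nat.clog Q (k + 1)

end RankMetric

/-!
The rank distance is invariant under translations, under changes of basis of `F ^ n` and under
`F`-linear automorphisms of `K`, so the size of the intersection of two balls depends only on the
distance `w` of the centers. It does not increase with `w` (`interCount_antitone`): zeroing one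
coordinate of the difference of the centers does not shrink the intersection, because with the other
coordinates of a vector fixed the admissible values of this one form an intersection of translates
of two subspaces of `K`, and the subspaces themselves always meet in at least as many points.

The sequence `h` follows a fixed family of codes through the nested Gabidulin codes, which are
linear MRD (`isLinearMRD_gabidulin`). At `K₀` the balls around the codewords are disjoint. A
codeword added inside the code of dimension `s` covers at least the volume of a ball minus
its intersections with the earlier balls; its distances to the earlier codewords are at least
`n + 1 - s`, and distance `l` occurs at most as often as there are codewords of rank `l`, so by
monotonicity the greedy distribution `mu` is the worst case (`sum_interBalls_le_sum_mu`).

For `u'`, count pairs of an uncovered vector and a center covering it. The centers lie outside the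
code, and also in the union of the balls around the `u` uncovered vectors, whose size is at most
`unionBound u` since among more than `Q ^ l` vectors two are at distance at most `n - l`
(`ncard_biUnion_ball_le`). The best center is thus at least as good as the average
(`exists_uncovered_mul_vol_le`), and the resulting bound is monotone in `u`
(`sub_le_sub_ceil_div`). As long as a vector is uncovered its whole ball avoids the code; this makes
`u'` reach `0` without becoming negative (`exists_uncovered_le_of_greedy_step`).

A code that covers everything may have covering radius below `ρ`. Zeroing one coordinate of all its
words raises the covering radius by at most `1` and does not enlarge the code, and the code `{0}`
has covering radius `n`, so some intermediate code has covering radius exactly `ρ`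
(`minCovering_le_card`).
-/

namespace RankMetric

/-! ### The rank weight -/

section Weight

variable (F : Type*) {K : Type*} [Field F] [Field K] [Algebra F K] {n : ℕ}

theorem span_range_finite (x : Fin n → K) : FiniteDimensional F (Submodule.span F (Set.range x)) :=
  FiniteDimensional.span_of_finite F (Set.finite_range x)

theorem rankWeight_le_of_forall_mem {x y : Fin n → K}
    (h : ∀ i, x i ∈ Submodule.span F (Set.range y)) : rankWeight F x ≤ rankWeight F y := by
  have := span_range_finite F y
  apply Submodule.finrank_mono
  rw [Submodule.span_le]
  rintro _ ⟨i, rfl⟩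
  exact h i

@[simp] theorem rankWeight_zero : rankWeight F (0 : Fin n → K) = 0 := by
  have h : Submodule.span F (Set.range (0 : Fin n → K)) = ⊥ := by
    rw [Submodule.span_eq_bot]
    rintro _ ⟨i, rfl⟩
    rfl
  rw [rankWeight, h, finrank_bot]

theorem rankWeight_neg (x : Fin n → K) : rankWeight F (-x) = rankWeight F x := by
  apply le_antisymm <;> apply rankWeight_le_of_forall_mem <;> intro i
  · exact neg_mem (Submodule.subset_span ⟨i, rfl⟩)
  · exact (neg_neg (x i)) ▸ neg_mem (Submodule.subset_span ⟨i, rfl⟩)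

theorem rankWeight_add_le (x y : Fin n → K) :
    rankWeight F (x + y) ≤ rankWeight F x + rankWeight F y := by
  have := span_range_finite F x
  have := span_range_finite F y
  refine le_trans (Submodule.finrank_mono ?_) (Submodule.finrank_add_le_finrank_add_finrank _ _)
  rw [Submodule.span_le]
  rintro _ ⟨i, rfl⟩
  exact Submodule.add_mem_sup (Submodule.subset_span ⟨i, rfl⟩) (Submodule.subset_span ⟨i, rfl⟩)

theorem rankWeight_le (x : Fin n → K) : rankWeight F x ≤ n := by
  simpa [rankWeight, Set.finrank] using finrank_range_le_card (R := F) x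

theorem rankWeight_eq_of_linearIndependent {x : Fin n → K} (hx : LinearIndependent F x) :
    rankWeight F x = n := by
  simpa [rankWeight] using finrank_span_eq_card hx

theorem rankWeight_le_card_of_eq_zero {x : Fin n → K} (s : Finset (Fin n))
    (h : ∀ i ∉ s, x i = 0) : rankWeight F x ≤ s.card := by
  classical
  have : FiniteDimensional F (Submodule.span F ((s.image x : Finset K) : Set K)) :=
    FiniteDimensional.span_finset F _
  refine le_trans (Submodule.finrank_mono ?_)
    ((finrank_span_finset_le_card (s.image x)).trans Finset.card_image_le)
  rw [Submodule.span_le]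
  rintro _ ⟨i, rfl⟩
  by_cases hi : i ∈ s
  · exact Submodule.subset_span (by simpa using ⟨i, hi, rfl⟩)
  · rw [h i hi]
    exact zero_mem _

theorem rankWeight_single_le (i : Fin n) (t : K) : rankWeight F (Pi.single i t) ≤ 1 := by
  refine rankWeight_le_card_of_eq_zero F {i} fun j hj => ?_
  simp only [Finset.mem_singleton] at hj
  simp [hj]

theorem rankWeight_update_le (x : Fin n → K) (i : Fin n) (s t : K) :
    rankWeight F (Function.update x i s) ≤ rankWeight F (Function.update x i t) + 1 := by
  have h : Function.update x i s = Function.update x i t + Pi.single i (s - t) := by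
    ext j
    rcases eq_or_ne j i with rfl | hj <;> simp [*]
  rw [h]
  exact (rankWeight_add_le F _ _).trans (by gcongr; exact rankWeight_single_le F i _)

theorem rankDist_self (x : Fin n → K) : rankDist F x x = 0 := by simp [rankDist]

theorem rankDist_comm (x y : Fin n → K) : rankDist F x y = rankDist F y x := by
  rw [rankDist, rankDist, ← rankWeight_neg, neg_sub]

theorem rankDist_triangle (x y z : Fin n → K) :
    rankDist F x z ≤ rankDist F x y + rankDist F y z := by
  simpa [rankDist] using rankWeight_add_le F (x - y) (y - z)

theorem rankDist_le (x y : Fin n → K) : rankDist F x y ≤ n := rankWeight_le F _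

/-- Replace the first `j` coordinates of `x` by `0`. -/
def zeroFirst (j : ℕ) (x : Fin n → K) : Fin n → K := fun i => if (i : ℕ) < j then 0 else x i

theorem zeroFirst_zero (x : Fin n → K) : zeroFirst 0 x = x := by
  ext i; simp [zeroFirst]

theorem zeroFirst_length (x : Fin n → K) : zeroFirst n x = 0 := by
  ext i; simp [zeroFirst]

theorem zeroFirst_succ (j : Fin n) (x : Fin n → K) :
    zeroFirst (j + 1) x = Function.update (zeroFirst j x) j 0 := by
  ext i
  rcases eq_or_ne i j with rfl | hi
  · simp [zeroFirst]
  · have : (i : ℕ) ≠ j := fun h => hi (Fin.ext h)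
    simp only [zeroFirst, Function.update_of_ne hi]
    congr 1
    simp; omega

end Weight

/-- A sequence of natural numbers that never climbs by more than `1` hits every value between its
initial value and a later one. -/
theorem exists_eq_of_le_succ {r : ℕ → ℕ} {n c : ℕ} (h0 : r 0 ≤ c) (hn : c ≤ r n)
    (h : ∀ j < n, r (j + 1) ≤ r j + 1) : ∃ j ≤ n, r j = c := by
  induction n with
  | zero => exact ⟨0, le_rfl, by omega⟩
  | succ n ih =>
    by_cases hc : c ≤ r n
    · obtain ⟨j, hj, e⟩ := ih hc fun j hj => h j (by omega)
      exact ⟨j, by omega, e⟩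
    · have := h n (by omega)
      exact ⟨n + 1, le_rfl, by omega⟩

/-! ### Intersections of two balls -/

/-- Two linear maps of the same rank between finite-dimensional spaces are equivalent. -/
theorem exists_equiv_comp_eq_of_finrank_range_eq {F V W : Type*} [Field F] [AddCommGroup V]
    [Module F V] [AddCommGroup W] [Module F W] [FiniteDimensional F V]
    {f g : V →ₗ[F] W}
    (h : Module.finrank F (LinearMap.range f) = Module.finrank F (LinearMap.range g)) :
    ∃ (P : V ≃ₗ[F] V) (L : W ≃ₗ[F] W), L.toLinearMap ∘ₗ f ∘ₗ P.toLinearMap = g := by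
  have hk : Module.finrank F (LinearMap.ker g) = Module.finrank F (LinearMap.ker f) := by
    have h1 := f.finrank_range_add_finrank_ker
    have h2 := g.finrank_range_add_finrank_ker
    omega
  obtain ⟨P, hP⟩ := Submodule.exists_linearEquiv_restrict_eq (LinearEquiv.ofFinrankEq _ _ hk)
  have hker : LinearMap.ker (f ∘ₗ P.toLinearMap) = LinearMap.ker g := by
    symm
    apply Submodule.eq_of_le_of_finrank_eq
    · intro x hx
      have := (LinearEquiv.ofFinrankEq _ _ hk ⟨x, hx⟩).2
      rw [hP] at this
      simpa using this
    · have h1 := (f ∘ₗ P.toLinearMap).finrank_range_add_finrank_ker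
      have h2 := f.finrank_range_add_finrank_ker
      rw [LinearMap.range_comp_of_range_eq_top _ P.range] at h1
      omega
  let e := (f ∘ₗ P.toLinearMap).quotKerEquivRange.symm ≪≫ₗ
    (Submodule.quotEquivOfEq _ _ hker) ≪≫ₗ g.quotKerEquivRange
  obtain ⟨L, hL⟩ := Submodule.exists_linearEquiv_restrict_eq e
  refine ⟨P, L, LinearMap.ext fun x => ?_⟩
  have h1 := hL ⟨(f ∘ₗ P.toLinearMap) x, x, rfl⟩
  have h2 : (f ∘ₗ P.toLinearMap).quotKerEquivRange.symm ⟨(f ∘ₗ P.toLinearMap) x, x, rfl⟩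
      = Submodule.Quotient.mk x := by
    rw [LinearEquiv.symm_apply_eq]
    rfl
  simp only [e, LinearEquiv.trans_apply, h2, Submodule.quotEquivOfEq_mk,
    LinearMap.quotKerEquivRange_apply_mk] at h1
  exact h1.symm

section Intersection

variable (F : Type*) {K : Type*} [Field F] [Field K] [Algebra F K] {n : ℕ}

/-- Vectors of equal rank weight are related by a linear bijection that preserves the rank weight:
a change of basis of `F ^ n` followed by an `F`-linear automorphism of `K`. -/
theorem exists_rankWeight_preserving {z w : Fin n → K} (h : rankWeight F z = rankWeight F w) :
    ∃ Φ : (Fin n → K) ≃ₗ[F] (Fin n → K), Φ z = w ∧ ∀ y, rankWeight F (Φ y) = rankWeight F y := by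
  let e : (Fin n → K) ≃ₗ[F] ((Fin n → F) →ₗ[F] K) := (Pi.basisFun F (Fin n)).constr F
  have hr (x : Fin n → K) : rankWeight F x = Module.finrank F (LinearMap.range (e x)) := by
    rw [rankWeight, ← Module.Basis.constr_range (Pi.basisFun F (Fin n)) F]
  obtain ⟨P, L, hPL⟩ := exists_equiv_comp_eq_of_finrank_range_eq (f := e z) (g := e w)
    (by rw [← hr, ← hr, h])
  refine ⟨e ≪≫ₗ (P.symm.arrowCongr L) ≪≫ₗ e.symm, ?_, fun y => ?_⟩
  · simp only [LinearEquiv.trans_apply, LinearEquiv.symm_apply_eq]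
    exact hPL
  · have : e ((e ≪≫ₗ (P.symm.arrowCongr L) ≪≫ₗ e.symm) y) =
        L.toLinearMap ∘ₗ e y ∘ₗ P.toLinearMap := e.apply_symm_apply _
    rw [hr, hr, this, LinearMap.range_comp, LinearEquiv.finrank_map_eq,
      LinearMap.range_comp_of_range_eq_top _ P.range]

/-- With all coordinates but one fixed, the values of the last one that keep the rank weight
at most `r` form a set that is empty or an `F`-subspace; only closure under differences is used. -/
theorem rankWeight_update_sub_le {b : Fin n → K} {i : Fin n} {s t : K} {r : ℕ}
    (hs : rankWeight F (Function.update b i s) ≤ r)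
    (ht : rankWeight F (Function.update b i t) ≤ r) :
    rankWeight F (Function.update b i (s - t)) ≤ r := by
  set V := Submodule.span F (Set.range (Function.update b i 0)) with hV
  by_cases hr : rankWeight F (Function.update b i 0) < r
  · exact (rankWeight_update_le F b i _ 0).trans hr
  · -- Here the other coordinates already span a space of dimension at least `r`, so it holds `t`.
    have key {t : K} (ht : rankWeight F (Function.update b i t) ≤ r) : t ∈ V := by
      have := span_range_finite F (Function.update b i t)
      have hle : V ≤ Submodule.span F (Set.range (Function.update b i t)) := by
        rw [hV, Submodule.span_le]
        rintro _ ⟨j, rfl⟩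
        rcases eq_or_ne j i with rfl | hj
        · simp
        · exact Submodule.subset_span ⟨j, by simp [hj]⟩
      rw [Submodule.eq_of_le_of_finrank_le hle (ht.trans (not_lt.1 hr))]
      exact Submodule.subset_span ⟨i, by simp⟩
    have h0 : rankWeight F (Function.update b i 0) ≤ r := by
      refine le_trans (rankWeight_le_of_forall_mem F fun j => ?_) hs
      rcases eq_or_ne j i with rfl | hj
      · simp
      · exact Submodule.subset_span ⟨j, by simp [hj]⟩
    refine (rankWeight_le_of_forall_mem F fun j => ?_).trans h0
    rcases eq_or_ne j i with rfl | hj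
    · rw [Function.update_self]
      exact sub_mem (key hs) (key ht)
    · exact Submodule.subset_span ⟨j, by simp [hj]⟩

/-- Number of vectors at rank distance at most `r` from `0` and at most `s` from `z`. -/
noncomputable def interCount (r s : ℕ) (z : Fin n → K) : ℕ :=
  {y : Fin n → K | rankWeight F y ≤ r ∧ rankWeight F (y - z) ≤ s}.ncard

theorem ncard_ball_inter_ball (r s : ℕ) (x y : Fin n → K) :
    (ball F r x ∩ ball F s y).ncard = interCount F r s (y - x) := by
  rw [interCount, ← Set.ncard_image_of_injective _ (add_left_injective (-x))]
  congr 1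
  ext t
  simp only [Set.mem_image, Set.mem_inter_iff, ball, Set.mem_ofPred_eq, rankDist]
  constructor
  · rintro ⟨t, ⟨h1, h2⟩, rfl⟩
    exact ⟨by rwa [← sub_eq_add_neg], by rwa [show t + -x - (y - x) = t - y by abel]⟩
  · rintro ⟨h1, h2⟩
    exact ⟨t + x, ⟨by rwa [add_sub_cancel_right], by
      rwa [show t + x - y = t - (y - x) by abel]⟩, by abel⟩

theorem ncard_ball (r : ℕ) (x : Fin n → K) : (ball F r x).ncard = vol F K n r := by
  rw [vol, ← Set.ncard_image_of_injective _ (add_left_injective (-x))]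
  congr 1
  ext t
  simp only [Set.mem_image, ball, Set.mem_ofPred_eq, rankDist, sub_zero]
  constructor
  · rintro ⟨t, h1, rfl⟩
    rwa [← sub_eq_add_neg]
  · intro h
    exact ⟨t + x, by rwa [add_sub_cancel_right], by abel⟩

/-- Zeroing the coordinates one at a time lowers the rank weight to `0` in steps of at most `1`. -/
theorem exists_rankWeight_zeroFirst_eq {w : Fin n → K} {c : ℕ} (h : c ≤ rankWeight F w) :
    ∃ j ≤ n, rankWeight F (zeroFirst j w) = c := by
  obtain ⟨j, -, e⟩ := exists_eq_of_le_succ (r := fun j => rankWeight F (zeroFirst (n - j) w))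
    (n := n) (c := c) (by simp [zeroFirst_length]) (by simpa [zeroFirst_zero] using h) (by
      intro j hj
      have e : n - j = (⟨n - (j + 1), by omega⟩ : Fin n) + 1 := by simp only; omega
      rw [e, zeroFirst_succ]
      conv_lhs => rw [← Function.update_eq_self (⟨n - (j + 1), by omega⟩ : Fin n)
        (zeroFirst (n - (j + 1)) w)]
      exact rankWeight_update_le F _ _ _ _)
  exact ⟨n - j, by omega, e⟩

variable [Finite K]

/-- Zeroing one coordinate of the difference of the centers does not shrink the intersection.
With the other coordinates of a vector fixed, the intersection is an intersection of translates of
two subspaces of `K`, hence empty or a translate of the intersection of the subspaces themselves. -/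
theorem interCount_le_update (r s : ℕ) (z : Fin n → K) (i : Fin n) :
    interCount F r s z ≤ interCount F r s (Function.update z i 0) := by
  set A := {y : Fin n → K | rankWeight F y ≤ r ∧ rankWeight F (y - z) ≤ s} with hA
  have hc (b : Fin n → K) : ∃ t : K, ∀ y ∈ A, Function.update y i 0 = b →
      Function.update y i t ∈ A := by
    by_cases h : ∃ y ∈ A, Function.update y i 0 = b
    · obtain ⟨y, hy, rfl⟩ := h
      refine ⟨y i, fun y' _ hy' => ?_⟩
      have : Function.update y' i (y i) = y := by
        rw [← Function.update_idem (a := i) 0 (y i) y', hy', Function.update_idem,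
          Function.update_eq_self]
      rwa [this]
    · exact ⟨0, fun y hy e => (h ⟨y, hy, e⟩).elim⟩
  choose c hc using hc
  refine Set.ncard_le_ncard_of_injOn
    (fun y => Function.update y i (y i - c (Function.update y i 0))) ?_ ?_ (Set.toFinite _)
  · intro y hy
    have h1 := hc _ y hy rfl
    set t := c (Function.update y i 0)
    have e (u : K) : Function.update y i u - z = Function.update (y - z) i (u - z i) := by
      ext j
      rcases eq_or_ne j i with rfl | hj <;> simp [*]
    refine ⟨rankWeight_update_sub_le F (by simpa using hy.1) h1.1, ?_⟩
    have h2 := hy.2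
    have h3 := h1.2
    rw [e] at h3
    have h4 := rankWeight_update_sub_le F (b := y - z) (i := i) (s := y i - z i) (r := s)
      (by simpa [← Pi.sub_apply] using h2) h3
    rw [sub_sub_sub_cancel_right] at h4
    convert h4 using 2
    ext j
    rcases eq_or_ne j i with rfl | hj <;> simp [*]
  · intro y _ y' _ h
    have h0 : Function.update y i 0 = Function.update y' i 0 := by
      have := congrArg (fun x => Function.update x i 0) h
      simpa using this
    ext j
    rcases eq_or_ne j i with rfl | hj
    · have := congrFun h j
      simp only [Function.update_self, h0] at this
      simpa using this
    · simpa [hj] using congrFun h0 j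

theorem interCount_le_of_rankWeight_eq (r s : ℕ) {z w : Fin n → K}
    (h : rankWeight F z = rankWeight F w) : interCount F r s z ≤ interCount F r s w := by
  obtain ⟨Φ, rfl, hΦ⟩ := exists_rankWeight_preserving F h
  refine Set.ncard_le_ncard_of_injOn Φ ?_ Φ.injective.injOn (Set.toFinite _)
  intro y hy
  exact ⟨by rw [hΦ]; exact hy.1, by rw [← map_sub, hΦ]; exact hy.2⟩

/-- The size of the intersection of two balls does not increase with the distance of the centers.
Zeroing the coordinates of the longer difference one at a time lowers its rank in steps of at most
`1`, so it passes through the rank of the shorter one. -/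
theorem interCount_antitone (r s : ℕ) {z w : Fin n → K}
    (h : rankWeight F z ≤ rankWeight F w) : interCount F r s w ≤ interCount F r s z := by
  have hmono : ∀ j ≤ n, interCount F r s w ≤ interCount F r s (zeroFirst j w) := by
    intro j
    induction j with
    | zero => simp [zeroFirst_zero]
    | succ j ih =>
      intro hj
      rw [zeroFirst_succ (⟨j, hj⟩ : Fin n)]
      exact (ih (by omega)).trans (interCount_le_update F r s _ _)
  obtain ⟨j, hj, e⟩ := exists_rankWeight_zeroFirst_eq F h
  exact (hmono j hj).trans (interCount_le_of_rankWeight_eq F r s e)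

theorem interBalls_le_ncard_of_rankDist_le {w : ℕ} (r s : ℕ) {x y : Fin n → K}
    (h : rankDist F x y ≤ w) : interBalls F K n r s w ≤ (ball F r x ∩ ball F s y).ncard := by
  refine csSup_le' ?_
  rintro _ ⟨x', y', h', rfl⟩
  rw [ncard_ball_inter_ball, ncard_ball_inter_ball]
  apply interCount_antitone
  rw [rankDist_comm] at h h'
  exact h.trans h'.ge

theorem ncard_le_interBalls (r s : ℕ) (x y : Fin n → K) :
    (ball F r x ∩ ball F s y).ncard ≤ interBalls F K n r s (rankDist F x y) := by
  refine le_csSup ⟨Nat.card (Fin n → K), ?_⟩ ⟨x, y, rfl, rfl⟩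
  rintro _ ⟨_, _, -, rfl⟩
  exact Set.ncard_le_card _

theorem interBalls_succ_le (r s w : ℕ) :
    interBalls F K n r s (w + 1) ≤ interBalls F K n r s w := by
  refine csSup_le' ?_
  rintro _ ⟨x, y, h, rfl⟩
  -- A pair of centers at distance `w` comes from zeroing coordinates of `y - x`.
  have hw : w ≤ rankWeight F (y - x) := by rw [rankDist_comm, rankDist] at h; omega
  obtain ⟨j, -, e⟩ := exists_rankWeight_zeroFirst_eq F hw
  set z := zeroFirst j (y - x)
  have hz : rankDist F 0 z = w := by rw [rankDist_comm, rankDist, sub_zero]; exact e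
  have h1 := ncard_le_interBalls F r s 0 z
  rw [hz] at h1
  refine le_trans ?_ h1
  rw [ncard_ball_inter_ball, ncard_ball_inter_ball]
  apply interCount_antitone
  rw [sub_zero, e]
  exact hw

theorem interBalls_antitone (r s : ℕ) : Antitone (interBalls F K n r s) :=
  antitone_nat_of_succ_le (interBalls_succ_le F r s)

theorem interBalls_le_vol (r s w : ℕ) : interBalls F K n r s w ≤ vol F K n r := by
  refine csSup_le' ?_
  rintro _ ⟨x, y, h, rfl⟩
  rw [← ncard_ball F r x]
  exact Set.ncard_le_ncard Set.inter_subset_left (Set.toFinite _)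

theorem interBalls_eq_zero {r s w : ℕ} (h : r + s < w) : interBalls F K n r s w = 0 := by
  refine le_antisymm (csSup_le' ?_) (Nat.zero_le _)
  rintro _ ⟨x, y, hxy, rfl⟩
  rw [nonpos_iff_eq_zero, Set.ncard_eq_zero, Set.eq_empty_iff_forall_notMem]
  rintro t ⟨h1, h2⟩
  have := rankDist_triangle F x t y
  rw [rankDist_comm F x t] at this
  simp only [ball, Set.mem_ofPred_eq] at h1 h2
  omega

theorem vol_pos (r : ℕ) : 0 < vol F K n r :=
  (Set.ncard_pos (Set.toFinite _)).2 ⟨0, by simp [ball, rankDist]⟩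

end Intersection

/-! ### Gabidulin codes and the Singleton bound -/

section Gabidulin

variable (F : Type*) {K : Type*} [Field F] [Finite F] [Field K] [Finite K] [Algebra F K] {n : ℕ}

/-- The linearized polynomial `∑ j < s, a j X ^ (q ^ j)`, as an `F`-linear map. -/
noncomputable def linearizedMap (s : ℕ) (a : Fin s → K) : K →ₗ[F] K :=
  letI := Fintype.ofFinite F
  ∑ j : Fin s, (LinearMap.mulLeft F (a j)) ∘ₗ
    ((FiniteField.frobeniusAlgHom F K) ^ (j : ℕ)).toLinearMap

omit [Finite K] in
theorem linearizedMap_apply (s : ℕ) (a : Fin s → K) (t : K) :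
    linearizedMap F s a t = ∑ j : Fin s, a j * t ^ (Nat.card F ^ (j : ℕ)) := by
  let := Fintype.ofFinite F
  simp only [linearizedMap, LinearMap.sum_apply, LinearMap.comp_apply, LinearMap.mulLeft_apply,
    AlgHom.toLinearMap_apply, AlgHom.coe_pow, FiniteField.coe_frobeniusAlgHom, pow_iterate,
    Nat.card_eq_fintype_card]

/-- A nonzero linearized polynomial of `q`-degree less than `s` has at most `q ^ (s - 1)` roots. -/
theorem finrank_ker_linearizedMap_lt {s : ℕ} {a : Fin s → K} (ha : a ≠ 0) :
    Module.finrank F (LinearMap.ker (linearizedMap F s a)) < s := by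
  classical
  obtain ⟨j₀, hj₀⟩ := Function.ne_iff.1 ha
  have hs : 0 < s := j₀.pos
  have hq : 1 < Nat.card F := Finite.one_lt_card
  let p : Polynomial K := ∑ j : Fin s, Polynomial.C (a j) * Polynomial.X ^ (Nat.card F ^ (j : ℕ))
  have hp : p ≠ 0 := by
    intro h
    have := congrArg (fun p => Polynomial.coeff p (Nat.card F ^ (j₀ : ℕ))) h
    simp only [p, Polynomial.finsetSum_coeff, Polynomial.coeff_C_mul_X_pow, Polynomial.coeff_zero,
      (Nat.pow_right_injective hq).eq_iff, Fin.val_inj] at this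
    simp at this
    exact hj₀ this
  have hdeg : p.natDegree ≤ Nat.card F ^ (s - 1) := by
    refine Polynomial.natDegree_sum_le_of_forall_le _ _ fun j _ => ?_
    refine (Polynomial.natDegree_C_mul_X_pow_le _ _).trans ?_
    exact Nat.pow_le_pow_right hq.le (by omega)
  set V := LinearMap.ker (linearizedMap F s a)
  let Z : Finset K := (Set.toFinite (V : Set K)).toFinset
  have hZ : Z.card ≤ p.natDegree := by
    refine Polynomial.card_le_degree_of_subset_roots fun t ht => ?_
    have ht : linearizedMap F s a t = 0 := by simpa [Z, V] using ht
    rw [Polynomial.mem_roots hp, Polynomial.IsRoot, ← ht, linearizedMap_apply]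
    simp [p, Polynomial.eval_finsetSum]
  have hcard : Z.card = Nat.card F ^ Module.finrank F V := by
    rw [← Module.natCard_eq_pow_finrank, ← Set.ncard_eq_toFinset_card]
    rfl
  have := (Nat.pow_le_pow_iff_right hq).1 ((hcard ▸ hZ).trans hdeg)
  omega

/-- Evaluating a nonzero linearized polynomial of `q`-degree less than `s` at `n` linearly
independent points gives rank weight at least `n - s + 1`. -/
theorem lt_rankWeight_linearizedMap_add {s : ℕ} {a : Fin s → K} (ha : a ≠ 0) {g : Fin n → K}
    (hg : LinearIndependent F g) :
    n < rankWeight F (fun i => linearizedMap F s a (g i)) + s := by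
  set A := linearizedMap F s a
  set W := Submodule.span F (Set.range g)
  have hW : Module.finrank F W = n := rankWeight_eq_of_linearIndependent F hg
  have hx : rankWeight F (fun i => A (g i)) =
      Module.finrank F (LinearMap.range (A.domRestrict W)) := by
    rw [LinearMap.range_domRestrict, Submodule.map_span, ← Set.range_comp]
    rfl
  have h1 := (A.domRestrict W).finrank_range_add_finrank_ker
  have h2 : Module.finrank F (LinearMap.ker (A.domRestrict W)) ≤
      Module.finrank F (LinearMap.ker A) := by
    rw [← Submodule.finrank_map_subtype_eq]
    apply Submodule.finrank_mono
    rintro _ ⟨x, hx, rfl⟩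
    simpa using hx
  have h3 : Module.finrank F (LinearMap.ker A) < s := finrank_ker_linearizedMap_lt F ha
  omega

/-- The Gabidulin code of dimension `s`: evaluations at `g` of the linearized polynomials of
`q`-degree less than `s`. -/
noncomputable def gabidulin (g : Fin n → K) (s : ℕ) : Submodule K (Fin n → K) :=
  Submodule.span K (Set.range fun (j : Fin s) (i : Fin n) => g i ^ (Nat.card F ^ (j : ℕ)))

omit [Field F] [Finite F] [Finite K] [Algebra F K] in
theorem gabidulin_mono (g : Fin n → K) : Monotone (gabidulin F g) := by
  intro s t hst
  apply Submodule.span_mono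
  rintro _ ⟨j, rfl⟩
  exact ⟨Fin.castLE hst j, rfl⟩

omit [Finite K] in
theorem sum_smul_frobenius (g : Fin n → K) {s : ℕ} (a : Fin s → K) :
    ∑ j : Fin s, a j • (fun i : Fin n => g i ^ (Nat.card F ^ (j : ℕ))) =
      fun i => linearizedMap F s a (g i) := by
  ext i
  simp [linearizedMap_apply]

theorem lt_rankWeight_add_of_mem_gabidulin {g : Fin n → K} (hg : LinearIndependent F g) {s : ℕ}
    {x : Fin n → K} (hx : x ∈ gabidulin F g s) (h0 : x ≠ 0) : n < rankWeight F x + s := by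
  obtain ⟨a, rfl⟩ := (Submodule.mem_span_range_iff_exists_fun K).1 hx
  rw [sum_smul_frobenius] at h0 ⊢
  refine lt_rankWeight_linearizedMap_add F ?_ hg
  rintro rfl
  exact h0 (by ext i; simp [linearizedMap_apply])

theorem finrank_gabidulin {g : Fin n → K} (hg : LinearIndependent F g) {s : ℕ} (hs : s ≤ n) :
    Module.finrank K (gabidulin F g s) = s := by
  have h : LinearIndependent K fun (j : Fin s) (i : Fin n) => g i ^ (Nat.card F ^ (j : ℕ)) := by
    rw [Fintype.linearIndependent_iff]
    intro a ha
    by_contra! hne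
    have h1 := lt_rankWeight_linearizedMap_add F (a := a) (Function.ne_iff.2 hne) hg
    rw [← sum_smul_frobenius, ha, rankWeight_zero] at h1
    omega
  exact (finrank_span_eq_card h).trans (Fintype.card_fin s)

theorem natCard_gabidulin {g : Fin n → K} (hg : LinearIndependent F g) {s : ℕ} (hs : s ≤ n) :
    Nat.card (gabidulin F g s) = Nat.card K ^ s := by
  rw [Module.natCard_eq_pow_finrank (K := K), finrank_gabidulin F hg hs]

omit [Finite F] in
/-- Singleton bound: by the pigeonhole principle, two vectors agree in their first `l`
coordinates. -/
theorem exists_rankDist_le_of_lt_card {l : ℕ} (hl : l ≤ n) {S : Finset (Fin n → K)}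
    (hS : Nat.card K ^ l < S.card) :
    ∃ x ∈ S, ∃ y ∈ S, x ≠ y ∧ rankDist F x y ≤ n - l := by
  classical
  let := Fintype.ofFinite K
  obtain ⟨x, hx, y, hy, hxy, h⟩ := Finset.exists_ne_map_eq_of_card_lt_of_maps_to
    (t := (Finset.univ : Finset (Fin l → K))) (by simpa using hS)
    (f := fun (x : Fin n → K) i => x (Fin.castLE hl i))
    (fun _ _ => Finset.mem_coe.2 (Finset.mem_univ _))
  refine ⟨x, hx, y, hy, hxy, ?_⟩
  have hc : (Finset.univ.map (Fin.castLEEmb hl))ᶜ.card = n - l := by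
    simp [Finset.card_compl]
  rw [← hc]
  refine rankWeight_le_card_of_eq_zero F _ fun i hi => ?_
  simp only [Finset.mem_compl, not_not, Finset.mem_map, Finset.mem_univ, true_and] at hi
  obtain ⟨i, rfl⟩ := hi
  simpa [sub_eq_zero] using congrFun h i

theorem isLinearMRD_gabidulin {g : Fin n → K} (hg : LinearIndependent F g) {s : ℕ} (h0 : 1 ≤ s)
    (hs : s ≤ n) : IsLinearMRD F (n + 1 - s) (gabidulin F g s) := by
  have hlow {x y : Fin n → K} (hx : x ∈ gabidulin F g s) (hy : y ∈ gabidulin F g s) (h : x ≠ y) :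
      n + 1 - s ≤ rankDist F x y := by
    have := lt_rankWeight_add_of_mem_gabidulin F hg (sub_mem hx hy) (sub_ne_zero.2 h)
    rw [rankDist]
    omega
  refine ⟨by rw [finrank_gabidulin F hg hs]; omega, ?_, ?_⟩
  · have hcard : (Set.toFinite (gabidulin F g s : Set (Fin n → K))).toFinset.card =
        Nat.card K ^ s := by
      rw [← Set.ncard_eq_toFinset_card, ← natCard_gabidulin F hg hs]
      rfl
    obtain ⟨x, hx, y, hy, hxy, h⟩ := exists_rankDist_le_of_lt_card F (l := s - 1) (by omega)
      (S := (Set.toFinite (gabidulin F g s : Set (Fin n → K))).toFinset) (by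
        rw [hcard]
        exact Nat.pow_lt_pow_right Finite.one_lt_card (by omega))
    simp only [Set.Finite.mem_toFinset, SetLike.mem_coe] at hx hy
    have := hlow hx hy hxy
    exact ⟨x, hx, y, hy, hxy, by omega⟩
  · rintro _ ⟨x, hx, y, hy, hxy, rfl⟩
    exact hlow hx hy hxy

omit [Finite F] in
theorem ncard_le_mrdCount {d : ℕ} {C : Submodule K (Fin n → K)} (hC : IsLinearMRD F d C) (r : ℕ) :
    {c : Fin n → K | c ∈ C ∧ rankWeight F c = r}.ncard ≤ mrdCount F K n d r := by
  refine le_csSup ⟨Nat.card (Fin n → K), ?_⟩ ⟨C, hC, rfl⟩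
  rintro _ ⟨_, -, rfl⟩
  exact Set.ncard_le_card _

end Gabidulin

/-! ### Greedy counts and the union bound -/

/-- Among all counts `b l ≤ M l` of total at most `k`, the greedy counts `mu` maximise every
initial sum, hence also the weighted sum for any nonincreasing weight. -/
theorem sum_mul_le_sum_mu_mul {M b I : ℕ → ℕ} {d k : ℕ} (hM : ∀ l, b l ≤ M l)
    (hb : ∀ t, ∑ l ∈ Finset.Ico d t, b l ≤ k) (hI : Antitone I) (t : ℕ) :
    ∑ l ∈ Finset.Ico d t, b l * I l ≤ ∑ l ∈ Finset.Ico d t, mu M d k l * I l := by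
  have hpart (t : ℕ) : ∑ l ∈ Finset.Ico d t, b l ≤ ∑ l ∈ Finset.Ico d t, mu M d k l := by
    induction t with
    | zero => simp
    | succ t ih =>
      by_cases h : d ≤ t
      · have hk := hb (t + 1)
        have hMt := hM t
        rw [Finset.sum_Ico_succ_top h] at hk ⊢
        rw [Finset.sum_Ico_succ_top h, mu_eq]
        omega
      · rw [Finset.Ico_eq_empty (by omega)]
        simp
  -- Abel summation: the excess of the initial sums, weighted by the last weight, is carried along.
  have key : ((∑ l ∈ Finset.Ico d t, mu M d k l : ℤ) - ∑ l ∈ Finset.Ico d t, (b l : ℤ)) * I t ≤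
      ∑ l ∈ Finset.Ico d t, (mu M d k l : ℤ) * I l - ∑ l ∈ Finset.Ico d t, (b l : ℤ) * I l := by
    induction t with
    | zero => simp
    | succ t ih =>
      by_cases h : d ≤ t
      · have h1 : (0 : ℤ) ≤ (∑ l ∈ Finset.Ico d (t + 1), mu M d k l : ℤ) -
            ∑ l ∈ Finset.Ico d (t + 1), (b l : ℤ) := by
          have := hpart (t + 1)
          exact sub_nonneg.2 (by exact_mod_cast this)
        have h2 : (I (t + 1) : ℤ) ≤ I t := by exact_mod_cast hI (Nat.le_succ t)
        refine (mul_le_mul_of_nonneg_left h2 h1).trans ?_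
        simp only [Finset.sum_Ico_succ_top h]
        linarith
      · rw [Finset.Ico_eq_empty (by omega)]
        simp
  have h1 : (0 : ℤ) ≤ ((∑ l ∈ Finset.Ico d t, mu M d k l : ℤ) -
      ∑ l ∈ Finset.Ico d t, (b l : ℤ)) * I t := by
    have := hpart t
    exact mul_nonneg (sub_nonneg.2 (by exact_mod_cast this)) (by positivity)
  have h2 := h1.trans key
  have h3 := sub_nonneg.1 h2
  exact_mod_cast h3

section UnionBound

variable (F : Type*) (K : Type*) [Field F] [Field K] [Finite K] [Algebra F K] (n : ℕ)

omit [Finite K] in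
theorem unionBound_one (ρ : ℕ) : unionBound F K n ρ 1 = vol F K n ρ := by
  simp [unionBound]

theorem unionBound_succ (ρ : ℕ) {k : ℕ} (h1 : 1 ≤ k) (hk : k < Nat.card K ^ n) :
    unionBound F K n ρ (k + 1) = unionBound F K n ρ k +
      ((vol F K n ρ : ℤ) - interBalls F K n ρ ρ (n - Nat.log (Nat.card K) k)) := by
  have hQ : 1 < Nat.card K := Finite.one_lt_card
  set Q := Nat.card K with hQdef
  set l := Nat.log Q k with hl
  have hlow : Q ^ l ≤ k := Nat.pow_log_le_self Q (by omega)
  have hup : k < Q ^ (l + 1) := Nat.lt_pow_succ_log_self hQ k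
  have hln : l < n := (Nat.pow_lt_pow_iff_right hQ).1 (hlow.trans_lt hk)
  simp only [unionBound, ← hQdef, ← hl]
  rcases (Nat.succ_le_of_lt hup).eq_or_lt with h | h
  · -- At a power of `Q` the two formulas for the slope change meet.
    have e : Nat.log Q (k + 1) = l + 1 := by
      rw [← Nat.succ_eq_add_one, h, Nat.log_pow hQ]
    have hk' : (k : ℤ) = (Q : ℤ) ^ (l + 1) - 1 := by
      rw [eq_sub_iff_add_eq]
      exact_mod_cast h
    rw [e, Finset.sum_Icc_succ_top (by omega), show n - (l + 1) + 1 = n - l by omega]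
    push_cast
    rw [hk']
    ring
  · have e : Nat.log Q (k + 1) = l :=
      (Nat.log_eq_iff (Or.inr ⟨hQ, by omega⟩)).2 ⟨hlow.trans (Nat.le_succ k), h⟩
    rw [e]
    push_cast
    ring

theorem unionBound_mono (ρ : ℕ) {i j : ℕ} (hi : 1 ≤ i) (hij : i ≤ j) (hj : j ≤ Nat.card K ^ n) :
    unionBound F K n ρ i ≤ unionBound F K n ρ j := by
  induction j, hij using Nat.le_induction with
  | base => exact le_rfl
  | succ j hij ih =>
    rw [unionBound_succ F K n ρ (hi.trans hij) hj]
    have : (interBalls F K n ρ ρ (n - Nat.log (Nat.card K) j) : ℤ) ≤ vol F K n ρ := by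
      exact_mod_cast interBalls_le_vol F ρ ρ _
    have := ih (by omega)
    linarith

theorem vol_le_unionBound (ρ : ℕ) {k : ℕ} (h1 : 1 ≤ k) (hk : k ≤ Nat.card K ^ n) :
    (vol F K n ρ : ℤ) ≤ unionBound F K n ρ k :=
  unionBound_one F K n ρ ▸ unionBound_mono F K n ρ le_rfl h1 hk

variable {K n}

/-- `unionBound` bounds the volume of a union of balls: by the Singleton bound, `k + 1` centers
contain two at distance at most `n - log_Q k`, and one of these adds at most
`vol - interBalls (n - log_Q k)` new vectors. -/
theorem ncard_biUnion_ball_le (ρ : ℕ) {S : Finset (Fin n → K)} (hS : S.Nonempty) :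
    ((⋃ x ∈ S, ball F ρ x).ncard : ℤ) ≤ unionBound F K n ρ S.card := by
  classical
  have hQ : 1 < Nat.card K := Finite.one_lt_card
  obtain ⟨k, hk⟩ : ∃ k, S.card = k + 1 := ⟨S.card - 1, by have := hS.card_pos; omega⟩
  induction k generalizing S with
  | zero =>
    obtain ⟨x, rfl⟩ := Finset.card_eq_one.1 hk
    simp [unionBound_one, ncard_ball]
  | succ k ih =>
    set l := Nat.log (Nat.card K) (k + 1) with hl
    have hlow : Nat.card K ^ l ≤ k + 1 := Nat.pow_log_le_self _ (by omega)
    have hN : k + 2 ≤ Nat.card K ^ n := by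
      have : S.card ≤ Nat.card (Fin n → K) := by
        rw [← Set.ncard_coe_finset]
        exact Set.ncard_le_card _
      rw [Nat.card_fun, Nat.card_fin] at this
      omega
    have hln : l < n := (Nat.pow_lt_pow_iff_right hQ).1 (by omega)
    obtain ⟨x, hx, y, hy, hxy, hd⟩ := exists_rankDist_le_of_lt_card F hln.le (S := S) (by omega)
    have hc : (S.erase x).card = k + 1 := by rw [Finset.card_erase_of_mem hx]; omega
    have hy' : y ∈ S.erase x := Finset.mem_erase.2 ⟨hxy.symm, hy⟩
    have h1 := ih ⟨y, hy'⟩ hc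
    have h2 : (⋃ z ∈ S, ball F ρ z) ⊆
        (⋃ z ∈ S.erase x, ball F ρ z) ∪ (ball F ρ x \ ball F ρ y) := by
      intro t ht
      simp only [Set.mem_iUnion, exists_prop] at ht
      obtain ⟨z, hz, ht⟩ := ht
      by_cases hzx : z = x
      · subst hzx
        by_cases hty : t ∈ ball F ρ y
        · exact Or.inl (Set.mem_biUnion hy' hty)
        · exact Or.inr ⟨ht, hty⟩
      · exact Or.inl (Set.mem_biUnion (Finset.mem_erase.2 ⟨hzx, hz⟩ :) ht)
    have h3 := (Set.ncard_le_ncard h2 (Set.toFinite _)).trans (Set.ncard_union_le _ _)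
    have h4 := Set.ncard_inter_add_ncard_sdiff_eq_ncard (ball F ρ x) (ball F ρ y) (Set.toFinite _)
    have h5 := interBalls_le_ncard_of_rankDist_le F ρ ρ hd
    rw [ncard_ball] at h4
    rw [hc] at h1
    rw [hk, unionBound_succ F K n ρ (k := k + 1) (by omega) (by omega), ← hl]
    omega

end UnionBound

/-! ### Adding a codeword -/

section Step

variable (F : Type*) {K : Type*} [Field F] [Field K] [Finite K] [Algebra F K] {n : ℕ}

/-- The vectors that are not covered by `C` with radius `ρ`. -/
def uncoveredSet (ρ : ℕ) (C : Finset (Fin n → K)) : Set (Fin n → K) :=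
  {x | ∀ c ∈ C, ρ < rankDist F x c}

omit [Finite K] in
theorem ncard_uncoveredSet (ρ : ℕ) (C : Finset (Fin n → K)) :
    (uncoveredSet F ρ C).ncard = uncovered F ρ C := rfl

theorem uncovered_insert [DecidableEq (Fin n → K)] (ρ : ℕ) (C : Finset (Fin n → K))
    (c : Fin n → K) :
    (uncoveredSet F ρ C ∩ ball F ρ c).ncard + uncovered F ρ (insert c C) = uncovered F ρ C := by
  rw [← ncard_uncoveredSet, ← ncard_uncoveredSet,
    ← Set.ncard_inter_add_ncard_sdiff_eq_ncard (uncoveredSet F ρ C) (ball F ρ c) (Set.toFinite _)]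
  congr 2
  ext x
  simp only [uncoveredSet, ball, Finset.mem_insert, forall_eq_or_imp, Set.mem_ofPred_eq,
    Set.mem_sdiff, not_le]
  tauto

theorem uncovered_insert_le_sub [DecidableEq (Fin n → K)] (ρ : ℕ) (C : Finset (Fin n → K))
    (c : Fin n → K) :
    (uncovered F ρ (insert c C) : ℤ) ≤ uncovered F ρ C - vol F K n ρ +
      ∑ x ∈ C, (interBalls F K n ρ ρ (rankDist F c x) : ℤ) := by
  have hsub : ball F ρ c ⊆
      (uncoveredSet F ρ C ∩ ball F ρ c) ∪ ⋃ x ∈ C, (ball F ρ c ∩ ball F ρ x) := by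
    intro t ht
    by_cases hu : t ∈ uncoveredSet F ρ C
    · exact Or.inl ⟨hu, ht⟩
    · simp only [uncoveredSet, Set.mem_ofPred_eq, not_forall, not_lt] at hu
      obtain ⟨x, hx, h⟩ := hu
      exact Or.inr (Set.mem_biUnion (s := (C : Set (Fin n → K))) hx ⟨ht, h⟩)
  have h1 := (Set.ncard_le_ncard hsub (Set.toFinite _)).trans (Set.ncard_union_le _ _)
  have h2 := Finset.set_ncard_biUnion_le C fun x => ball F ρ c ∩ ball F ρ x
  have h3 : ∑ x ∈ C, (ball F ρ c ∩ ball F ρ x).ncard ≤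
      ∑ x ∈ C, interBalls F K n ρ ρ (rankDist F c x) :=
    Finset.sum_le_sum fun x _ => ncard_le_interBalls F ρ ρ c x
  have h4 := uncovered_insert F ρ C c
  rw [ncard_ball] at h1
  have h5 : (∑ x ∈ C, (interBalls F K n ρ ρ (rankDist F c x) : ℤ)) =
    ((∑ x ∈ C, interBalls F K n ρ ρ (rankDist F c x) : ℕ) : ℤ) := by push_cast; rfl
  omega

/-- The balls around the codewords of a code of minimum distance greater than `2 ρ` are disjoint. -/
theorem uncovered_add_card_mul_vol {ρ : ℕ} {C : Finset (Fin n → K)}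
    (hC : ∀ x ∈ C, ∀ y ∈ C, x ≠ y → 2 * ρ < rankDist F x y) :
    uncovered F ρ C + C.card * vol F K n ρ = Nat.card K ^ n := by
  classical
  induction C using Finset.induction_on with
  | empty =>
    have : uncoveredSet F ρ (∅ : Finset (Fin n → K)) = Set.univ := by simp [uncoveredSet]
    rw [← ncard_uncoveredSet, this, Set.ncard_univ, Nat.card_fun, Nat.card_fin]
    simp
  | insert c C hc ih =>
    have ih := ih fun x hx y hy => hC x (Finset.mem_insert_of_mem hx) y
      (Finset.mem_insert_of_mem hy)
    have hball : uncoveredSet F ρ C ∩ ball F ρ c = ball F ρ c := by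
      rw [Set.inter_eq_right]
      intro t ht x hx
      have h1 := hC c (Finset.mem_insert_self c C) x (Finset.mem_insert_of_mem hx)
        (fun e => hc (e ▸ hx))
      have h2 := rankDist_triangle F c t x
      rw [rankDist_comm F c t] at h2
      have h3 : rankDist F t c ≤ ρ := ht
      omega
    have h := uncovered_insert F ρ C c
    rw [hball, ncard_ball] at h
    rw [Finset.card_insert_of_notMem hc, add_mul]
    omega

/-- If some vector is uncovered, then no codeword lies in the ball around it. -/
theorem card_add_vol_le_of_uncovered_pos {ρ : ℕ} {C : Finset (Fin n → K)}
    (h : 0 < uncovered F ρ C) : C.card + vol F K n ρ ≤ Nat.card K ^ n := by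
  obtain ⟨x, hx⟩ := (Set.ncard_pos (Set.toFinite (uncoveredSet F ρ C))).1 h
  have hd : Disjoint (C : Set (Fin n → K)) (ball F ρ x) := by
    rw [Set.disjoint_left]
    intro c hc hcx
    have h1 := hx c hc
    rw [rankDist_comm] at h1
    exact absurd hcx (not_le.2 h1)
  rw [← Set.ncard_coe_finset, ← ncard_ball F ρ x,
    ← Set.ncard_union_eq hd (Set.toFinite _) (Set.toFinite _)]
  simpa [Nat.card_fun] using Set.ncard_le_card ((C : Set (Fin n → K)) ∪ ball F ρ x)

/-- Averaging: the balls around the `u` uncovered vectors contain `u * vol` incidences, spread over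
at most `min (Q ^ n - |C|) (unionBound u)` centers outside `C`. -/
theorem exists_uncovered_mul_vol_le {ρ : ℕ} {C : Finset (Fin n → K)} (h : 0 < uncovered F ρ C) :
    ∃ c ∉ C, (uncovered F ρ C * vol F K n ρ : ℤ) ≤
      min ((Nat.card K : ℤ) ^ n - C.card) (unionBound F K n ρ (uncovered F ρ C)) *
        (uncoveredSet F ρ C ∩ ball F ρ c).ncard := by
  classical
  set U := (Set.toFinite (uncoveredSet F ρ C)).toFinset with hU
  have hUcard : U.card = uncovered F ρ C := by
    rw [hU, ← Set.ncard_eq_toFinset_card]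
    rfl
  have hUne : U.Nonempty := Finset.card_pos.1 (hUcard ▸ h)
  set T := (Set.toFinite (⋃ y ∈ U, ball F ρ y)).toFinset with hT
  have hTcard : T.card = (⋃ y ∈ U, ball F ρ y).ncard := by
    rw [hT, ← Set.ncard_eq_toFinset_card]
  have hmemT {x : Fin n → K} : x ∈ T ↔ ∃ y ∈ U, rankDist F x y ≤ ρ := by
    simp [hT, ball]
  have hTne : T.Nonempty := by
    obtain ⟨y, hy⟩ := hUne
    exact ⟨y, hmemT.2 ⟨y, hy, by simp [rankDist_self]⟩⟩
  have hTC {x : Fin n → K} (hx : x ∈ T) : x ∉ C := by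
    obtain ⟨y, hy, hxy⟩ := hmemT.1 hx
    intro hc
    have : y ∈ uncoveredSet F ρ C := by simpa [hU] using hy
    have := this x hc
    rw [rankDist_comm] at this
    omega
  have hT1 : T.card + C.card ≤ Nat.card K ^ n := by
    rw [← Finset.card_union_of_disjoint (Finset.disjoint_left.2 fun _ => hTC),
      ← Set.ncard_coe_finset]
    simpa [Nat.card_fun] using Set.ncard_le_card ((T ∪ C : Finset (Fin n → K)) : Set (Fin n → K))
  have hT2 : (T.card : ℤ) ≤ unionBound F K n ρ (uncovered F ρ C) := by
    rw [hTcard, ← hUcard]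
    exact ncard_biUnion_ball_le F ρ hUne
  -- Count the pairs of an uncovered vector and a center that covers it.
  have hdc := Finset.sum_card_bipartiteAbove_eq_sum_card_bipartiteBelow (s := T) (t := U)
    (fun x y => rankDist F x y ≤ ρ)
  have hbelow : ∀ y ∈ U, (T.bipartiteBelow (fun x y => rankDist F x y ≤ ρ) y).card =
      vol F K n ρ := by
    intro y hy
    rw [← ncard_ball F ρ y, ← Set.ncard_coe_finset]
    congr 1
    ext x
    simp only [Finset.mem_coe, Finset.mem_bipartiteBelow, ball, Set.mem_ofPred_eq,
      and_iff_right_iff_imp]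
    exact fun hx => hmemT.2 ⟨y, hy, hx⟩
  have habove (x : Fin n → K) : (U.bipartiteAbove (fun x y => rankDist F x y ≤ ρ) x).card =
      (uncoveredSet F ρ C ∩ ball F ρ x).ncard := by
    rw [← Set.ncard_coe_finset]
    congr 1
    ext y
    simp [hU, ball, rankDist_comm F x y]
  rw [Finset.sum_congr rfl hbelow, Finset.sum_const, smul_eq_mul, hUcard] at hdc
  obtain ⟨c, hc, hmax⟩ := Finset.exists_max_image T
    (fun x => (uncoveredSet F ρ C ∩ ball F ρ x).ncard) hTne
  refine ⟨c, hTC hc, ?_⟩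
  have h1 : uncovered F ρ C * vol F K n ρ ≤ T.card * (uncoveredSet F ρ C ∩ ball F ρ c).ncard := by
    rw [← hdc, ← smul_eq_mul]
    exact Finset.sum_le_card_nsmul _ _ _ fun x hx => (habove x).trans_le (hmax x hx)
  have h2 : (uncovered F ρ C * vol F K n ρ : ℤ) ≤
      T.card * (uncoveredSet F ρ C ∩ ball F ρ c).ncard := by exact_mod_cast h1
  refine h2.trans (mul_le_mul_of_nonneg_right ?_ (by positivity))
  refine le_min ?_ hT2
  rw [le_sub_iff_add_le]
  exact_mod_cast hT1

end Step

/-- `u ↦ u - ⌈u v / D⌉` is nondecreasing in `u` and in `D ≥ v`. -/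
theorem sub_le_sub_ceil_div {u u' w v D : ℤ} (hu : u ≤ u') (hv : 0 < v) (hD : v ≤ D)
    (h : u * v ≤ D * w) : u - w ≤ u' - ⌈((u' : ℚ) * v) / D⌉ := by
  have hD0 : (0 : ℚ) < D := by exact_mod_cast hv.trans_le hD
  rw [le_sub_comm, Int.ceil_le, div_le_iff₀ hD0]
  have : u' * v ≤ (u' - (u - w)) * D := by
    nlinarith [mul_nonneg (sub_nonneg.2 hu) (sub_nonneg.2 hD)]
  exact_mod_cast this

section Nested

variable (F : Type*) {K : Type*} [Field F] [Finite F] [Field K] [Finite K] [Algebra F K] {n : ℕ}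

/-- The distances from a new codeword of the Gabidulin code of dimension `s` to the old codewords
are at least `n + 1 - s`, and each is taken no more often than there are words of that weight. -/
theorem sum_interBalls_le_sum_mu {g : Fin n → K} (hg : LinearIndependent F g) {s ρ : ℕ}
    (h0 : 1 ≤ s) (hs : s ≤ n) {C : Finset (Fin n → K)} (hC : ∀ x ∈ C, x ∈ gabidulin F g s)
    {c : Fin n → K} (hc : c ∈ gabidulin F g s) (hcC : c ∉ C) :
    ∑ x ∈ C, interBalls F K n ρ ρ (rankDist F c x) ≤
      ∑ l ∈ Finset.Icc (n + 1 - s) (min n (2 * ρ)),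
        mu (mrdCount F K n (n + 1 - s)) (n + 1 - s) C.card l * interBalls F K n ρ ρ l := by
  classical
  set d := n + 1 - s with hd
  set a := min n (2 * ρ) with ha
  let b : ℕ → ℕ := fun l => (C.filter fun x => rankDist F c x = l).card
  have hbM (l : ℕ) : b l ≤ mrdCount F K n d l := by
    refine le_trans ?_ (ncard_le_mrdCount F (isLinearMRD_gabidulin F hg h0 hs) l)
    simp only [b, ← Set.ncard_coe_finset]
    refine Set.ncard_le_ncard_of_injOn (fun x => c - x) ?_
      (fun x _ y _ h => sub_right_injective h) (Set.toFinite _)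
    intro x hx
    simp only [Finset.coe_filter, Set.mem_ofPred_eq] at hx
    exact ⟨sub_mem hc (hC x hx.1), hx.2⟩
  have hmaps : ∀ x ∈ C, rankDist F c x ∈ Finset.Ico d (n + 1) := by
    intro x hx
    have h1 := rankDist_le F c x
    have h2 := lt_rankWeight_add_of_mem_gabidulin F hg (sub_mem hc (hC x hx))
      (sub_ne_zero.2 fun e => hcC (e ▸ hx))
    rw [Finset.mem_Ico]
    simp only [rankDist] at *
    omega
  have hbk (t : ℕ) : ∑ l ∈ Finset.Ico d t, b l ≤ C.card := by
    rw [← Finset.card_biUnion fun i _ j _ hij => ?_]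
    · exact Finset.card_le_card (Finset.biUnion_subset.2 fun l _ => Finset.filter_subset _ _)
    · rw [Function.onFun, Finset.disjoint_filter]
      exact fun x _ hi hj => hij (hi.symm.trans hj)
  have hsum : ∑ x ∈ C, interBalls F K n ρ ρ (rankDist F c x) =
      ∑ l ∈ Finset.Ico d (n + 1), b l * interBalls F K n ρ ρ l := by
    rw [← Finset.sum_fiberwise_of_maps_to hmaps]
    refine Finset.sum_congr rfl fun l _ => ?_
    rw [Finset.sum_congr rfl fun x hx => by rw [(Finset.mem_filter.1 hx).2], Finset.sum_const,
      smul_eq_mul]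
  -- Balls whose centers are at distance greater than `2 ρ` are disjoint.
  have hcut : ∑ l ∈ Finset.Ico d (n + 1), b l * interBalls F K n ρ ρ l =
      ∑ l ∈ Finset.Ico d (a + 1), b l * interBalls F K n ρ ρ l := by
    symm
    refine Finset.sum_subset (Finset.Ico_subset_Ico_right (by omega)) fun l h1 h2 => ?_
    simp only [Finset.mem_Ico, not_and, not_lt] at h1 h2
    rw [interBalls_eq_zero F (by omega), mul_zero]
  rw [hsum, hcut]
  exact sum_mul_le_sum_mu_mul hbM hbk (interBalls_antitone F ρ ρ) (a + 1)

end Nested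

/-! ### Covering codes of a prescribed radius -/

section Radius

variable (F : Type*) {K : Type*} [Field F] [Field K] [Algebra F K] {n : ℕ}

theorem distToCode_le_iff {x : Fin n → K} {C : Finset (Fin n → K)} (hC : C.Nonempty) {r : ℕ} :
    distToCode F x C ≤ r ↔ ∃ c ∈ C, rankDist F x c ≤ r := by
  constructor
  · intro h
    obtain ⟨c, hc, e⟩ := Nat.sInf_mem
      (Set.Nonempty.image (fun c => rankDist F x c) (Finset.coe_nonempty.2 hC))
    exact ⟨c, hc, e.trans_le h⟩
  · rintro ⟨c, hc, h⟩
    exact (Nat.sInf_le (Set.mem_image_of_mem (fun c => rankDist F x c) hc)).trans h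

theorem bddAbove_range_distToCode {C : Finset (Fin n → K)} (hC : C.Nonempty) :
    BddAbove (Set.range fun x : Fin n → K => distToCode F x C) := by
  refine ⟨n, ?_⟩
  rintro _ ⟨x, rfl⟩
  obtain ⟨c, hc⟩ := hC
  exact (distToCode_le_iff F ⟨c, hc⟩).2 ⟨c, hc, rankDist_le F x c⟩

/-- The covering radius of `C`: the largest distance from a vector to `C`. -/
noncomputable def coveringRadius (C : Finset (Fin n → K)) : ℕ :=
  sSup (Set.range fun x : Fin n → K => distToCode F x C)

theorem hasCoveringRadius_coveringRadius {C : Finset (Fin n → K)} (hC : C.Nonempty) :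
    HasCoveringRadius F C (coveringRadius F C) := by
  have hb := bddAbove_range_distToCode F hC
  exact ⟨hC, Nat.sSup_mem (Set.range_nonempty _) hb, fun _ h => le_csSup hb h⟩

theorem coveringRadius_le_iff {C : Finset (Fin n → K)} (hC : C.Nonempty) {r : ℕ} :
    coveringRadius F C ≤ r ↔ ∀ x : Fin n → K, ∃ c ∈ C, rankDist F x c ≤ r := by
  rw [coveringRadius, csSup_le_iff (bddAbove_range_distToCode F hC) (Set.range_nonempty _),
    Set.forall_mem_range]
  exact forall_congr' fun x => distToCode_le_iff F hC

/-- A code with covering radius at most `ρ` yields a code of no larger size with covering radius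
exactly `ρ`. Zeroing one coordinate of all codewords raises the covering radius by at most `1`, and
zeroing all coordinates leaves the code `{0}`, whose covering radius is `n`. -/
theorem minCovering_le_card [FiniteDimensional F K] {ρ : ℕ} (hn : n ≤ Module.finrank F K)
    (hρ : ρ ≤ n) {C : Finset (Fin n → K)} (hC : C.Nonempty)
    (h : ∀ x : Fin n → K, ∃ c ∈ C, rankDist F x c ≤ ρ) :
    minCovering F K n ρ ≤ C.card := by
  classical
  have hne (j : ℕ) : (C.image (zeroFirst j)).Nonempty := hC.image _
  obtain ⟨j, -, e⟩ : ∃ j ≤ n, coveringRadius F (C.image (zeroFirst j)) = ρ := by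
    refine exists_eq_of_le_succ (r := fun j => coveringRadius F (C.image (zeroFirst j))) ?_ ?_ ?_
    · rw [coveringRadius_le_iff F (hne 0)]
      intro x
      obtain ⟨c, hc, hx⟩ := h x
      exact ⟨c, Finset.mem_image.2 ⟨c, hc, zeroFirst_zero c⟩, hx⟩
    · obtain ⟨g, hg⟩ := exists_linearIndependent_of_le_finrank hn
      obtain ⟨c, hc, hr⟩ := (coveringRadius_le_iff F (hne n)).1 le_rfl g
      obtain ⟨c, -, rfl⟩ := Finset.mem_image.1 hc
      rw [zeroFirst_length, rankDist, sub_zero, rankWeight_eq_of_linearIndependent F hg] at hr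
      exact hρ.trans hr
    · intro j hj
      rw [coveringRadius_le_iff F (hne _)]
      intro x
      obtain ⟨c, hc, hr⟩ := (coveringRadius_le_iff F (hne j)).1 le_rfl x
      obtain ⟨c, hcC, rfl⟩ := Finset.mem_image.1 hc
      refine ⟨_, Finset.mem_image_of_mem _ hcC, (rankDist_triangle F x (zeroFirst j c) _).trans ?_⟩
      gcongr
      rw [zeroFirst_succ (⟨j, hj⟩ : Fin n), rankDist]
      refine (rankWeight_le_card_of_eq_zero F {⟨j, hj⟩} fun i hi => ?_).trans_eq (by simp)
      simp [Function.update_of_ne (by simpa using hi)]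
  refine (iInf₂_le (C.image (zeroFirst j)) ?_).trans ?_
  · rw [← e]
    exact hasCoveringRadius_coveringRadius F (hne j)
  · exact_mod_cast Finset.card_image_le

end Radius

/-! ### The two sequences -/

section Sequences

variable (F : Type*) {K : Type*} [Field F] [Field K] [Finite K] [Algebra F K] {n : ℕ}

theorem uncovered_gabidulin_add [Finite F] {g : Fin n → K} (hg : LinearIndependent F g) {ρ s : ℕ}
    (hs : s = n - min n (2 * ρ)) {C : Finset (Fin n → K)} (hC : ∀ x, x ∈ C ↔ x ∈ gabidulin F g s) :
    uncovered F ρ C + C.card * vol F K n ρ = Nat.card K ^ n := by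
  refine uncovered_add_card_mul_vol F fun x hx y hy hxy => ?_
  have h1 := lt_rankWeight_add_of_mem_gabidulin F hg
    (sub_mem ((hC x).1 hx) ((hC y).1 hy)) (sub_ne_zero.2 hxy)
  have h2 := rankWeight_le F (x - y)
  rw [rankDist]
  omega

theorem exists_finset_gabidulin [Finite F] {g : Fin n → K} (hg : LinearIndependent F g) {s : ℕ}
    (hs : s ≤ n) :
    ∃ C : Finset (Fin n → K), (∀ x, x ∈ C ↔ x ∈ gabidulin F g s) ∧ C.card = Nat.card K ^ s := by
  refine ⟨(Set.toFinite (gabidulin F g s : Set (Fin n → K))).toFinset, by simp, ?_⟩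
  rw [← Set.ncard_eq_toFinset_card, ← natCard_gabidulin F hg hs]
  rfl

/-- Words of the nested Gabidulin codes are added one at a time, exhausting each code before
passing to the next. -/
theorem exists_uncovered_le_of_step [Finite F] {g : Fin n → K} (hg : LinearIndependent F g)
    {ρ k₀ : ℕ} (hk₀ : k₀ = Nat.card K ^ (n - min n (2 * ρ))) {h : ℕ → ℤ}
    (h_init : h k₀ = (Nat.card K : ℤ) ^ n - k₀ * vol F K n ρ)
    (h_step : ∀ k, k₀ ≤ k → k < Nat.card K ^ n → h (k + 1) = h k - vol F K n ρ +
      ∑ l ∈ Finset.Icc (dIndex (Nat.card K) n k) (min n (2 * ρ)),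
        (mu (mrdCount F K n (dIndex (Nat.card K) n k)) (dIndex (Nat.card K) n k) k l : ℤ) *
          interBalls F K n ρ ρ l) {k : ℕ} (hk : k₀ ≤ k) (hkN : k ≤ Nat.card K ^ n) :
    ∃ C : Finset (Fin n → K), C.card = k ∧ (uncovered F ρ C : ℤ) ≤ h k ∧
      ∀ s, s ≤ n → k ≤ Nat.card K ^ s → ∀ x ∈ C, x ∈ gabidulin F g s := by
  classical
  have hQ : 1 < Nat.card K := Finite.one_lt_card
  induction k, hk using Nat.le_induction with
  | base =>
    obtain ⟨C, hC, hcard⟩ := exists_finset_gabidulin F hg (Nat.sub_le n (min n (2 * ρ)))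
    have h1 := uncovered_gabidulin_add F hg rfl hC
    refine ⟨C, by rw [hcard, hk₀], ?_, fun s _ hs x hx => ?_⟩
    · rw [h_init, hk₀, ← hcard, le_sub_iff_add_le]
      exact_mod_cast h1.le
    · rw [hk₀, Nat.pow_le_pow_iff_right hQ] at hs
      exact gabidulin_mono F g hs ((hC x).1 hx)
  | succ k hk ih =>
    obtain ⟨C, hcard, hle, hsub⟩ := ih (by omega)
    set s := Nat.clog (Nat.card K) (k + 1) with hs
    have hk0 : 0 < k := lt_of_lt_of_le (hk₀ ▸ Nat.pow_pos (by omega)) hk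
    have hs1 : 1 ≤ s := Nat.clog_pos hQ (by omega)
    have hsn : s ≤ n := Nat.clog_le_of_le_pow hkN
    have hks : k + 1 ≤ Nat.card K ^ s := Nat.le_pow_clog hQ _
    obtain ⟨G, hG, hGcard⟩ := exists_finset_gabidulin F hg hsn
    obtain ⟨c, hcG, hcC⟩ := Finset.exists_mem_notMem_of_card_lt_card (s := C) (t := G) (by omega)
    have hCs := hsub s hsn (by omega)
    have hc := (hG c).1 hcG
    refine ⟨insert c C, by rw [Finset.card_insert_of_notMem hcC, hcard], ?_,
      fun t ht hkt x hx => ?_⟩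
    · have h1 := uncovered_insert_le_sub F ρ C c
      have h2 := sum_interBalls_le_sum_mu F (ρ := ρ) hg hs1 hsn hCs hc hcC
      have h3 := h_step k hk (by omega)
      rw [show dIndex (Nat.card K) n k = n + 1 - s from rfl, ← hcard] at h3
      have h4 := Int.ofNat_le.2 h2
      push_cast at h4
      rw [hcard] at h3 h4
      linarith
    · have hst : s ≤ t := Nat.clog_le_of_le_pow hkt
      apply gabidulin_mono F g hst
      rcases Finset.mem_insert.1 hx with rfl | hx
      · exact hc
      · exact hCs x hx

/-- The refined sequence: besides the bound `h`, each step may add the codeword found by averaging.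
As long as `u' k` is positive, the ball volume is at most `Q ^ n - k`, so the fraction
is at most `u' k`. -/
theorem exists_uncovered_le_of_greedy_step {ρ k₀ : ℕ} {h u' : ℕ → ℤ}
    (hh : ∀ k, k₀ ≤ k → k ≤ Nat.card K ^ n →
      ∃ C : Finset (Fin n → K), C.card = k ∧ (uncovered F ρ C : ℤ) ≤ h k)
    (hinit : ∃ C : Finset (Fin n → K), C.card = k₀ ∧ (uncovered F ρ C : ℤ) = u' k₀)
    (u_step : ∀ k, k₀ ≤ k → k < Nat.card K ^ n → u' (k + 1) = min (h (k + 1))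
      (u' k - ⌈((u' k : ℚ) * vol F K n ρ) /
        min ((Nat.card K : ℚ) ^ n - k) (unionBound F K n ρ (u' k).toNat : ℚ)⌉))
    {k : ℕ} (hk : k₀ ≤ k) (hkN : k ≤ Nat.card K ^ n) :
    (∃ C : Finset (Fin n → K), C.card = k ∧ (uncovered F ρ C : ℤ) ≤ u' k) ∧
      u' k ≤ (Nat.card K : ℤ) ^ n ∧ (0 < u' k → k + vol F K n ρ ≤ Nat.card K ^ n) := by
  classical
  have hv : 0 < vol F K n ρ := vol_pos F ρ
  induction k, hk using Nat.le_induction with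
  | base =>
    obtain ⟨C, rfl, hC⟩ := hinit
    refine ⟨⟨C, rfl, hC.le⟩, ?_, fun hpos => ?_⟩
    · rw [← hC, ← ncard_uncoveredSet]
      have : (uncoveredSet F ρ C).ncard ≤ Nat.card K ^ n := by
        simpa [Nat.card_fun] using Set.ncard_le_card (uncoveredSet F ρ C)
      exact_mod_cast this
    · rw [← hC] at hpos
      exact card_add_vol_le_of_uncovered_pos F (by exact_mod_cast hpos)
  | succ k hk ih =>
    obtain ⟨⟨C, hcard, hC⟩, hub, hpos⟩ := ih (by omega)
    obtain ⟨C', hcard', hC'⟩ := hh (k + 1) (by omega) hkN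
    have hstep := u_step k hk hkN
    -- It suffices to treat the second term of the minimum.
    suffices H : (∃ C : Finset (Fin n → K), C.card = k + 1 ∧ (uncovered F ρ C : ℤ) ≤
        u' k - ⌈((u' k : ℚ) * vol F K n ρ) /
          min ((Nat.card K : ℚ) ^ n - k) (unionBound F K n ρ (u' k).toNat : ℚ)⌉) ∧
        u' (k + 1) ≤ (Nat.card K : ℤ) ^ n ∧
        (0 < u' (k + 1) → k + 1 + vol F K n ρ ≤ Nat.card K ^ n) by
      refine ⟨?_, H.2⟩
      rw [hstep]
      rcases min_choice (h (k + 1)) (u' k - ⌈((u' k : ℚ) * vol F K n ρ) /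
          min ((Nat.card K : ℚ) ^ n - k) (unionBound F K n ρ (u' k).toNat : ℚ)⌉) with e | e
      · exact e.symm ▸ ⟨C', hcard', hC'⟩
      · exact e.symm ▸ H.1
    have hu0 : 0 ≤ u' k := by omega
    obtain ⟨c₀, hc₀⟩ : ∃ c, c ∉ C := by
      by_contra! hall
      have : (Set.univ : Set (Fin n → K)).ncard = C.card := by
        rw [← Set.ncard_coe_finset]
        congr 1
        ext x
        simp [hall x]
      rw [Set.ncard_univ, Nat.card_fun, Nat.card_fin] at this
      omega
    have hins {c : Fin n → K} (hc : c ∉ C) : (insert c C).card = k + 1 := by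
      rw [Finset.card_insert_of_notMem hc, hcard]
    rcases hu0.eq_or_lt with hz | hp
    · rw [← hz] at hstep ⊢
      have h1 := uncovered_insert F ρ C c₀
      simp only [Int.cast_zero, zero_mul, zero_div, Int.ceil_zero, sub_zero] at hstep ⊢
      have h2 : u' (k + 1) ≤ 0 := hstep ▸ min_le_right _ _
      refine ⟨⟨_, hins hc₀, by omega⟩, h2.trans (by positivity), fun h3 => by omega⟩
    · have hkv := hpos hp
      set D : ℤ := min ((Nat.card K : ℤ) ^ n - k) (unionBound F K n ρ (u' k).toNat) with hD
      have hDq : min ((Nat.card K : ℚ) ^ n - k) (unionBound F K n ρ (u' k).toNat : ℚ) = D := by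
        rw [hD]
        push_cast
        rfl
      have hu1 : 1 ≤ (u' k).toNat := by omega
      have huN : (u' k).toNat ≤ Nat.card K ^ n := by
        rw [Int.toNat_le]
        exact_mod_cast hub
      have hvk : (vol F K n ρ : ℤ) ≤ (Nat.card K : ℤ) ^ n - k := by
        rw [le_sub_iff_add_le']
        exact_mod_cast hkv
      have hvD : (vol F K n ρ : ℤ) ≤ D := le_min hvk (vol_le_unionBound F K n ρ hu1 huN)
      have hv' : (0 : ℤ) < vol F K n ρ := by exact_mod_cast hv
      rw [hDq] at hstep ⊢
      have hceil : 0 ≤ ⌈((u' k : ℚ) * vol F K n ρ) / D⌉ := by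
        have h1 : (0 : ℚ) < D := by exact_mod_cast hv'.trans_le hvD
        have h2 : (0 : ℚ) < u' k := by exact_mod_cast hp
        positivity
      have hright : u' (k + 1) ≤ u' k - ⌈((u' k : ℚ) * vol F K n ρ) / D⌉ := hstep ▸ min_le_right _ _
      refine ⟨?_, by linarith, fun hp' => ?_⟩
      · obtain ⟨c, hc, hcle⟩ : ∃ c ∉ C, (uncovered F ρ C : ℤ) * vol F K n ρ ≤
            D * (uncoveredSet F ρ C ∩ ball F ρ c).ncard := by
          rcases Nat.eq_zero_or_pos (uncovered F ρ C) with h0 | h0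
          · refine ⟨c₀, hc₀, ?_⟩
            rw [h0]
            have : 0 ≤ D := hv'.le.trans hvD
            simp only [Nat.cast_zero, zero_mul]
            positivity
          · obtain ⟨c, hc, hcle⟩ := exists_uncovered_mul_vol_le F h0
            refine ⟨c, hc, hcle.trans (mul_le_mul_of_nonneg_right ?_ (by positivity))⟩
            rw [hcard]
            exact min_le_min le_rfl (unionBound_mono F K n ρ h0 (by omega) huN)
        refine ⟨insert c C, hins hc, ?_⟩
        have h1 := uncovered_insert F ρ C c
        have h2 := sub_le_sub_ceil_div hC hv' hvD hcle
        push_cast at h2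
        omega
      · -- At `k + vol = Q ^ n` the fraction equals `u' k`, so the sequence has reached `0`.
        by_contra hlt
        have hDv : D = vol F K n ρ := by
          refine le_antisymm ((min_le_left _ _).trans ?_) hvD
          rw [sub_le_iff_le_add']
          have : Nat.card K ^ n ≤ k + vol F K n ρ := by omega
          exact_mod_cast this
        have hvq : (vol F K n ρ : ℚ) ≠ 0 := by exact_mod_cast hv.ne'
        rw [hDv, Int.cast_natCast, mul_div_cancel_right₀ _ hvq, Int.ceil_intCast] at hright
        omega

end Sequences

end RankMetric

open RankMetric in
theorem proposition2
    (F K : Type*) [Field F] [Finite F] [Field K] [Finite K] [Algebra F K]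
    (q m n ρ : ℕ) (hq : Nat.card F = q) (hm : Module.finrank F K = m)
    (hn : 1 ≤ n) (hnm : n ≤ m) (hρ : ρ ≤ n)
    (a K₀ : ℕ) (ha : a = min n (2 * ρ)) (hK₀ : K₀ = q ^ (m * (n - a)))
    (h u' : ℕ → ℤ)
    (h_init : h K₀ = (q : ℤ) ^ (m * n) - (q : ℤ) ^ (m * (n - a)) * vol F K n ρ)
    (u_init : u' K₀ = (q : ℤ) ^ (m * n) - (q : ℤ) ^ (m * (n - a)) * vol F K n ρ)
    (h_step : ∀ k : ℕ, K₀ ≤ k → k < q ^ (m * n) →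
      h (k + 1) = h k - vol F K n ρ
        + ∑ l ∈ Finset.Icc (dIndex (q ^ m) n k) a,
            (mu (mrdCount F K n (dIndex (q ^ m) n k)) (dIndex (q ^ m) n k) k l : ℤ)
              * interBalls F K n ρ ρ l)
    (u_step : ∀ k : ℕ, K₀ ≤ k → k < q ^ (m * n) →
      u' (k + 1) = min (h (k + 1))
        (u' k - ⌈((u' k : ℚ) * vol F K n ρ) /
          min ((q : ℚ) ^ (m * n) - k) (unionBound F K n ρ (u' k).toNat : ℚ)⌉)) :
    -- both sequences bound the number of vectors left uncovered by some code of cardinality `k`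
    (∀ k : ℕ, K₀ ≤ k → k ≤ q ^ (m * n) →
      (∃ C : Finset (Fin n → K), C.card = k ∧ (uncovered F ρ C : ℤ) ≤ h k) ∧
      (∃ C : Finset (Fin n → K), C.card = k ∧ (uncovered F ρ C : ℤ) ≤ u' k)) ∧
    -- the minimum of `{k : u'_k = 0}` exists, and it bounds the size of an optimal covering code
    ∃ k₁ : ℕ, IsLeast {k : ℕ | K₀ ≤ k ∧ u' k = 0} k₁ ∧
      minCovering F K n ρ ≤ (k₁ : ℕ∞) := by
  have hQ : q ^ m = Nat.card K := by rw [Module.natCard_eq_pow_finrank (K := F) (V := K), hq, hm]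
  have hQz : (q : ℤ) ^ m = Nat.card K := by exact_mod_cast hQ
  have hQq : (q : ℚ) ^ m = Nat.card K := by exact_mod_cast hQ
  simp only [pow_mul, hQ, hQz, hQq] at *
  subst ha
  have hK1 : 1 < Nat.card K := Finite.one_lt_card
  have hK₀z : (K₀ : ℤ) = (Nat.card K : ℤ) ^ (n - min n (2 * ρ)) := by exact_mod_cast hK₀
  rw [← hK₀z] at h_init u_init
  obtain ⟨g, hg⟩ := exists_linearIndependent_of_le_finrank (hm ▸ hnm)
  have hh (k : ℕ) (hk : K₀ ≤ k) (hkN : k ≤ Nat.card K ^ n) :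
      ∃ C : Finset (Fin n → K), C.card = k ∧ (uncovered F ρ C : ℤ) ≤ h k := by
    obtain ⟨C, h1, h2, -⟩ := exists_uncovered_le_of_step F hg hK₀ h_init h_step hk hkN
    exact ⟨C, h1, h2⟩
  have hinit : ∃ C : Finset (Fin n → K), C.card = K₀ ∧ (uncovered F ρ C : ℤ) = u' K₀ := by
    obtain ⟨C, hC, hcard⟩ := exists_finset_gabidulin F hg (Nat.sub_le n (min n (2 * ρ)))
    have h1 := uncovered_gabidulin_add F hg rfl hC
    rw [hcard, ← hK₀] at h1
    refine ⟨C, by rw [hcard, hK₀], ?_⟩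
    rw [u_init, eq_sub_iff_add_eq]
    exact_mod_cast h1
  have hu {k : ℕ} (hk : K₀ ≤ k) (hkN : k ≤ Nat.card K ^ n) :=
    exists_uncovered_le_of_greedy_step F hh hinit u_step hk hkN
  refine ⟨fun k hk hkN => ⟨hh k hk hkN, (hu hk hkN).1⟩, ?_⟩
  have hK₀N : K₀ ≤ Nat.card K ^ n := by
    rw [hK₀]
    exact Nat.pow_le_pow_right hK1.le (Nat.sub_le _ _)
  have hend : u' (Nat.card K ^ n) = 0 := by
    obtain ⟨⟨C, -, hC⟩, -, hpos⟩ := hu hK₀N le_rfl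
    have hv : 0 < vol F K n ρ := vol_pos F ρ
    by_contra hne
    have := hpos (by omega)
    omega
  classical
  have hex : ∃ k, K₀ ≤ k ∧ u' k = 0 := ⟨_, hK₀N, hend⟩
  refine ⟨Nat.find hex, ⟨Nat.find_spec hex, fun k hk => Nat.find_min' hex hk⟩, ?_⟩
  obtain ⟨hk, hzero⟩ := Nat.find_spec hex
  obtain ⟨⟨C, hcard, hC⟩, -⟩ := hu hk (Nat.find_min' hex ⟨hK₀N, hend⟩)
  rw [← hcard]
  have hpos : 0 < C.card := by
    rw [hcard]
    exact lt_of_lt_of_le (hK₀ ▸ Nat.pow_pos (by omega)) hk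
  have hempty : uncoveredSet F ρ C = ∅ := by
    rw [← Set.ncard_eq_zero (Set.toFinite _), ncard_uncoveredSet]
    omega
  refine minCovering_le_card F (hm ▸ hnm) hρ (Finset.card_pos.1 hpos) fun x => ?_
  by_contra! hx
  exact (hempty ▸ (show x ∈ uncoveredSet F ρ C from hx) : x ∈ (∅ : Set (Fin n → K)))
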